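/- Let $\psi=(\psi_n)_{n\ge 0}\in\ell^2(\mathbb N,\mathbb C)$ with $\sum_n|\psi_n|^2=1$ be a pure state $|\psi\rangle=\sum_n\psi_n|n\rangle$ of one bosonic mode, written in the Fock basis. For $T\in[0,1]$ let $B(T)=\exp\big(\arccos\sqrt T\,(ab^\dagger-a^\dagger b)\big)$ be the beam splitter of transmission probability $T$ acting on the modes annihilated by $a$ and $b$, and put $$|\Psi_T\rangle=B(T)|\psi,0\rangle=\sum_n\psi_n\sum_{m=0}^n\sqrt{\tbinom nm T^m(1-T)^{n-m}}\;|m,n-m\rangle,\qquad \rho_T=\mathrm{Tr}_b\,|\Psi_T\rangle\langle\Psi_T|,$$ so that $\rho_T$ is the state $\psi$ subject to loss with transmission probability $T$. Let $\mathcal P_\psi(T)=\mathrm{Tr}[\rho_T^2]$ be the purity and $\mathcal M_\psi(T)=1-\mathcal P_\psi(T)$ the mixedness. Then, for every such $\psi$: 1. for every $T\in(0,1)$, $|\Psi_T\rangle$ is a unit vector and the series defining $\mathrm{Tr}[\rho_T^2]$ in the Fock basis converge, to a real number; 2. $\mathcal P_\psi$ is convex on $(0,1)$ and $\mathcal M_\psi$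 is concave on $(0,1)$; 3. $\mathcal P_\psi$ is twice continuously differentiable on $(0,1)$, and $\partial^2\mathcal P_\psi(T)/\partial T^2\ge 0$ for all $T\in(0,1)$; 4. there are coefficients $p_m\ge 0$ ($m\ge 0$), with $p_m=0$ for all odd $m$, such that $\mathcal P_\psi(T)=\sum_{m\ge 0}p_m(1-2T)^m$ for all $T\in(0,1)$. -/

import Mathlib

noncomputable section

namespace PhotonLoss

open scoped Nat

/-- Fock-basis coefficient functions of one bosonic mode: `φ n` is the coefficient of `|n⟩`.
The physical pure states are the unit vectors of the subspace `lp (fun _ : ℕ => ℂ) 2`. -/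
abbrev Mode : Type := ℕ → ℂ

/-- Fock-basis coefficient functions of two bosonic modes `a`, `b`:
`Φ (m, k)` is the coefficient of `|m, k⟩`. -/
abbrev TwoMode : Type := ℕ × ℕ → ℂ

/-- `a |m, k⟩ = √m |m - 1, k⟩`, written on coefficients. -/
def annA : Module.End ℂ TwoMode where
  toFun Φ := fun p => (√((p.1 : ℝ) + 1) : ℝ) * Φ (p.1 + 1, p.2)
  map_add' Φ Φ' := by funext p; simp [mul_add]
  map_smul' c Φ := by funext p; simp [mul_left_comm]

/-- `a† |m, k⟩ = √(m + 1) |m + 1, k⟩`, written on coefficients. -/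
def creA : Module.End ℂ TwoMode where
  toFun Φ := fun p => (√(p.1 : ℝ) : ℝ) * Φ (p.1 - 1, p.2)
  map_add' Φ Φ' := by funext p; simp [mul_add]
  map_smul' c Φ := by funext p; simp [mul_left_comm]

/-- `b |m, k⟩ = √k |m, k - 1⟩`, written on coefficients. -/
def annB : Module.End ℂ TwoMode where
  toFun Φ := fun p => (√((p.2 : ℝ) + 1) : ℝ) * Φ (p.1, p.2 + 1)
  map_add' Φ Φ' := by funext p; simp [mul_add]
  map_smul' c Φ := by funext p; simp [mul_left_comm]

/-- `b† |m, k⟩ = √(k + 1) |m, k + 1⟩`, written on coefficients. -/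
def creB : Module.End ℂ TwoMode where
  toFun Φ := fun p => (√(p.2 : ℝ) : ℝ) * Φ (p.1, p.2 - 1)
  map_add' Φ Φ' := by funext p; simp [mul_add]
  map_smul' c Φ := by funext p; simp [mul_left_comm]

/-- The beam-splitter generator `a b† - a† b`. It preserves the total photon number, so it acts
on each of the finite-dimensional spaces spanned by the `|m, k⟩` with `m + k = N`. -/
def bsGenerator : Module.End ℂ TwoMode := annA * creB - creA * annB

/-- The beam splitter `B(T) = exp (arccos √T (a b† - a† b))` of transmission probability `T`, as
the exponential series. Each coefficient of `B(T) Φ` involves only the finite-dimensional sector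
of its total photon number, so the series converges in every coefficient. -/
def beamSplitter (T : ℝ) (Φ : TwoMode) : TwoMode :=
  fun p => ∑' r : ℕ, ((r ! : ℂ)⁻¹ * (Real.arccos (√T) : ℂ) ^ r) * (bsGenerator ^ r) Φ p

/-- `|ψ, 0⟩`: the mode `a` in state `ψ`, the mode `b` in the vacuum. -/
def withVacuum (ψ : Mode) : TwoMode := fun p => if p.2 = 0 then ψ p.1 else 0

/-- `|Ψ_T⟩ = B(T) |ψ, 0⟩`. -/
def outputState (ψ : Mode) (T : ℝ) : TwoMode := beamSplitter T (withVacuum ψ)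

/-- The matrix of `|Φ⟩⟨Φ|`. -/
def projector (Φ : TwoMode) : Matrix (ℕ × ℕ) (ℕ × ℕ) ℂ := Matrix.vecMulVec Φ (star Φ)

/-- The partial trace over the mode `b`. -/
def partialTraceB (R : Matrix (ℕ × ℕ) (ℕ × ℕ) ℂ) : Matrix ℕ ℕ ℂ :=
  Matrix.of fun m n => ∑' k : ℕ, R (m, k) (n, k)

/-- `ρ_T = Tr_b |Ψ_T⟩⟨Ψ_T|`, the pure state `ψ` subject to loss with transmission
probability `T`, as a density matrix in the Fock basis. -/
def lossyState (ψ : Mode) (T : ℝ) : Matrix ℕ ℕ ℂ := partialTraceB (projector (outputState ψ T))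

/-- The product of two infinite matrices. -/
def matMul (A B : Matrix ℕ ℕ ℂ) : Matrix ℕ ℕ ℂ := Matrix.of fun i j => ∑' k : ℕ, A i k * B k j

/-- The trace of an infinite matrix. -/
def matTrace (A : Matrix ℕ ℕ ℂ) : ℂ := ∑' m : ℕ, A m m

/-- The purity `P_ψ(T) = Tr[ρ_T ^ 2]` (a real number). -/
def purity (ψ : Mode) (T : ℝ) : ℝ := (matTrace (matMul (lossyState ψ T) (lossyState ψ T))).re

/-- The mixedness (linear entropy) `M_ψ(T) = 1 - P_ψ(T)`. -/
def mixedness (ψ : Mode) (T : ℝ) : ℝ := 1 - purity ψ T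

theorem bsGenerator_apply (Φ : TwoMode) (m k : ℕ) :
    bsGenerator Φ (m, k) = (√((m : ℝ) + 1) : ℝ) * ((√(k : ℝ) : ℝ) * Φ (m + 1, k - 1)) -
      (√(m : ℝ) : ℝ) * ((√((k : ℝ) + 1) : ℝ) * Φ (m - 1, k + 1)) := rfl

/-- The state `|ψ, 0⟩` rotated by a complex angle `z`. -/
def rotated (ψ : Mode) (z : ℂ) : TwoMode := fun p =>
  ψ (p.1 + p.2) * (√((p.1 + p.2).choose p.1 : ℝ) : ℝ) * (Complex.cos z ^ p.1 * Complex.sin z ^ p.2)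

theorem rotated_zero (ψ : Mode) : rotated ψ 0 = withVacuum ψ := by
  funext ⟨m, k⟩
  rcases Nat.eq_zero_or_pos k with rfl | hk
  · simp [rotated, withVacuum]
  · simp [rotated, withVacuum, hk.ne']

theorem hasDerivAt_rotated (ψ : Mode) (p : ℕ × ℕ) (z : ℂ) :
    HasDerivAt (fun z => rotated ψ z p) (bsGenerator (rotated ψ z) p) z := by
  obtain ⟨m, k⟩ := p
  have h := (((Complex.hasDerivAt_cos z).pow m).mul ((Complex.hasDerivAt_sin z).pow k)).const_mul
    (ψ (m + k) * ((√((m + k).choose m : ℝ) : ℝ) : ℂ))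
  refine h.congr_deriv ?_
  rw [bsGenerator_apply]
  have e1 : ((√((m : ℝ) + 1) : ℝ) : ℂ) * (((√(k : ℝ) : ℝ) : ℂ) * rotated ψ z (m + 1, k - 1)) =
      ψ (m + k) * ((√((m + k).choose m : ℝ) : ℝ) : ℂ) *
        (Complex.cos z ^ m * (k * Complex.sin z ^ (k - 1) * Complex.cos z)) := by
    rcases k with _ | k
    · simp
    · have hc : √((m : ℝ) + 1) * √((k + 1 : ℕ) : ℝ) * √((m + 1 + k).choose (m + 1) : ℝ) =
          ((k + 1 : ℕ) : ℝ) * √((m + 1 + k).choose m : ℝ) := by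
        have hn : ((m : ℝ) + 1) * ((m + 1 + k).choose (m + 1) : ℝ) =
            ((k + 1 : ℕ) : ℝ) * ((m + 1 + k).choose m : ℝ) := by
          have := Nat.choose_succ_right_eq (m + 1 + k) m
          have h2 : m + 1 + k - m = k + 1 := by omega
          rw [h2] at this
          have h3 : (((m + 1 + k).choose (m + 1) * (m + 1) : ℕ) : ℝ) =
            (((m + 1 + k).choose m * (k + 1) : ℕ) : ℝ) := by rw [this]
          push_cast at h3 ⊢
          linarith
        rw [mul_right_comm, ← Real.sqrt_mul (by positivity), hn, Real.sqrt_mul (by positivity),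
          mul_right_comm, Real.mul_self_sqrt (by positivity)]
      have hc' := congrArg (fun x : ℝ => (x : ℂ)) hc
      simp only [Complex.ofReal_mul] at hc'
      have h4 : m + (k + 1) = m + 1 + k := by omega
      simp only [rotated, Nat.add_sub_cancel, h4]
      rw [pow_succ]
      linear_combination (ψ (m + 1 + k) * Complex.cos z ^ m * Complex.cos z *
        Complex.sin z ^ k) * hc'
  have e2 : ((√(m : ℝ) : ℝ) : ℂ) * (((√((k : ℝ) + 1) : ℝ) : ℂ) * rotated ψ z (m - 1, k + 1)) =
      ψ (m + k) * ((√((m + k).choose m : ℝ) : ℝ) : ℂ) *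
        ((m * Complex.cos z ^ (m - 1) * Complex.sin z) * Complex.sin z ^ k) := by
    rcases m with _ | m
    · simp
    · have hc : √((m + 1 : ℕ) : ℝ) * √((k : ℝ) + 1) * √((m + 1 + k).choose m : ℝ) =
          ((m + 1 : ℕ) : ℝ) * √((m + 1 + k).choose (m + 1) : ℝ) := by
        have hn : ((k : ℝ) + 1) * ((m + 1 + k).choose m : ℝ) =
            ((m + 1 : ℕ) : ℝ) * ((m + 1 + k).choose (m + 1) : ℝ) := by
          have := Nat.choose_succ_right_eq (m + 1 + k) m
          have h2 : m + 1 + k - m = k + 1 := by omega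
          rw [h2] at this
          have h3 : (((m + 1 + k).choose (m + 1) * (m + 1) : ℕ) : ℝ) =
            (((m + 1 + k).choose m * (k + 1) : ℕ) : ℝ) := by rw [this]
          push_cast at h3 ⊢
          linarith
        rw [mul_assoc, ← Real.sqrt_mul (by positivity), hn, Real.sqrt_mul (by positivity),
          ← mul_assoc, Real.mul_self_sqrt (by positivity)]
      have hc' := congrArg (fun x : ℝ => (x : ℂ)) hc
      simp only [Complex.ofReal_mul] at hc'
      have h4 : m + (k + 1) = m + 1 + k := by omega
      simp only [rotated, Nat.add_sub_cancel, h4]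
      rw [pow_succ]
      linear_combination (ψ (m + 1 + k) * Complex.cos z ^ m * Complex.sin z *
        Complex.sin z ^ k) * hc'
  rw [e1, e2]
  simp only [Pi.pow_apply]
  ring

theorem hasDerivAt_pow_rotated (ψ : Mode) (r : ℕ) (p : ℕ × ℕ) (z : ℂ) :
    HasDerivAt (fun z => (bsGenerator ^ r) (rotated ψ z) p)
      ((bsGenerator ^ (r + 1)) (rotated ψ z) p) z := by
  induction r generalizing p with
  | zero => simpa using hasDerivAt_rotated ψ p z
  | succ r ih =>
    obtain ⟨m, k⟩ := p
    have h := (((ih (m + 1, k - 1)).const_mul ((√(k : ℝ) : ℝ) : ℂ)).const_mul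
      ((√((m : ℝ) + 1) : ℝ) : ℂ)).sub
      (((ih (m - 1, k + 1)).const_mul ((√((k : ℝ) + 1) : ℝ) : ℂ)).const_mul ((√(m : ℝ) : ℝ) : ℂ))
    rw [pow_succ' bsGenerator (r + 1), pow_succ' bsGenerator r]
    simp only [Module.End.mul_apply, bsGenerator_apply] at h ⊢
    rw [pow_succ' bsGenerator r] at h
    exact h

/-- The exponential series that defines `B(T)|ψ, 0⟩` converges in every coefficient, and the state
is `∑ₙ ψₙ ∑ₘ √(C(n,m) T^m (1-T)^(n-m)) |m, n-m⟩`. -/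
theorem hasSum_outputState (ψ : Mode) {T : ℝ} (hT : T ∈ Set.Icc (0 : ℝ) 1) (m k : ℕ) :
    HasSum (fun r : ℕ => ((r ! : ℂ)⁻¹ * (Real.arccos (√T) : ℂ) ^ r) *
        (bsGenerator ^ r) (withVacuum ψ) (m, k))
      (ψ (m + k) * (√((m + k).choose m * T ^ m * (1 - T) ^ k) : ℝ)) := by
  have hd : Differentiable ℂ (fun z => rotated ψ z (m, k)) :=
    fun z => (hasDerivAt_rotated ψ (m, k) z).differentiableAt
  have hit : ∀ r : ℕ, iteratedDeriv r (fun z => rotated ψ z (m, k)) =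
      fun z => (bsGenerator ^ r) (rotated ψ z) (m, k) := by
    intro r
    induction r with
    | zero => simp
    | succ r ih =>
      rw [iteratedDeriv_succ, ih]
      funext z
      exact (hasDerivAt_pow_rotated ψ r (m, k) z).deriv
  have h := Complex.hasSum_taylorSeries_of_entire hd 0 (Real.arccos (√T) : ℂ)
  simp only [hit, rotated_zero, sub_zero, smul_eq_mul] at h
  have h0 : 0 ≤ √T := Real.sqrt_nonneg T
  have hcos : Complex.cos (Real.arccos (√T) : ℂ) = (√T : ℝ) := by
    rw [← Complex.ofReal_cos, Real.cos_arccos (by linarith) (Real.sqrt_le_one.mpr hT.2)]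
  have hsin : Complex.sin (Real.arccos (√T) : ℂ) = (√(1 - T) : ℝ) := by
    rw [← Complex.ofReal_sin, Real.sin_arccos, Real.sq_sqrt hT.1]
  have hv : rotated ψ (Real.arccos (√T) : ℂ) (m, k) =
      ψ (m + k) * (√((m + k).choose m * T ^ m * (1 - T) ^ k) : ℝ) := by
    have h1 : 0 ≤ 1 - T := by linarith [hT.2]
    have hp : √((m + k).choose m * T ^ m * (1 - T) ^ k) =
        √((m + k).choose m : ℝ) * (√T ^ m * √(1 - T) ^ k) := by
      rw [Real.sqrt_eq_iff_mul_self_eq (by have := hT.1; positivity) (by positivity)]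
      have a1 := Real.mul_self_sqrt (Nat.cast_nonneg (α := ℝ) ((m + k).choose m))
      have a2 : √T ^ m * √T ^ m = T ^ m := by rw [← mul_pow, Real.mul_self_sqrt hT.1]
      have a3 : √(1 - T) ^ k * √(1 - T) ^ k = (1 - T) ^ k := by
        rw [← mul_pow, Real.mul_self_sqrt h1]
      symm
      calc √((m + k).choose m : ℝ) * (√T ^ m * √(1 - T) ^ k) *
            (√((m + k).choose m : ℝ) * (√T ^ m * √(1 - T) ^ k))
          = (√((m + k).choose m : ℝ) * √((m + k).choose m : ℝ)) * (√T ^ m * √T ^ m) *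
            (√(1 - T) ^ k * √(1 - T) ^ k) := by ring
        _ = _ := by rw [a1, a2, a3]
    simp only [rotated, hcos, hsin, hp]
    push_cast
    ring
  rw [hv] at h
  simpa only [mul_assoc] using h

theorem outputState_apply (ψ : Mode) {T : ℝ} (hT : T ∈ Set.Icc (0 : ℝ) 1) (m k : ℕ) :
    outputState ψ T (m, k) = ψ (m + k) * (√((m + k).choose m * T ^ m * (1 - T) ^ k) : ℝ) :=
  (hasSum_outputState ψ hT m k).tsum_eq

end PhotonLoss

end

/-!
`Tr[ρ_T ^ 2]` involves two copies of `|Ψ_T⟩` and two of `⟨Ψ_T|`. Let `x`, `y` be commuting variables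
for the annihilation operators of the two ket copies of `ψ`, and `u`, `v` for those of the two bra
copies, and evaluate monomials by `xⁱ yʲ uᵏ vˡ ↦ ⟨0|aⁱ|ψ⟩ ⟨0|aʲ|ψ⟩ conj (⟨0|aᵏ|ψ⟩ ⟨0|aˡ|ψ⟩)`. The
part of `Tr[ρ_T ^ 2]` of total photon number `N` is then the value of `1 / N!` times the `N`-th
power of the quadratic form

  `T (x v + y u) + (1 - T) (x u + y v) = (1 - 2 T) / 2 * (x - y) (u - v) + 1 / 2 * (x + y) (u + v)`.

Expanding the right-hand side instead, `P_ψ(T) = ∑ (1 - 2 T) ^ r w(r, t)`, where `w(r, t)` is the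
probability of finding `r` and `t` photons behind a balanced beam splitter fed with `|ψ, ψ⟩`. Since
`|ψ, ψ⟩` is symmetric, `w(r, t)` vanishes for odd `r` (the Hong–Ou–Mandel effect). Convexity holds
term by term, and smoothness is that of a convergent power series.
-/

namespace PhotonLoss

open scoped Nat ComplexConjugate TensorProduct Polynomial
open Finset.HasAntidiagonal (antidiagonal)

section Series

theorem hasSum_sum_fiber {ι κ M : Type*} [AddCommMonoid M] [TopologicalSpace M] [ContinuousAdd M]
    [RegularSpace M] {f : ι → M} {a : M} (hf : HasSum f a) (π : ι → κ) (fiber : κ → Finset ι)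
    (hfiber : ∀ i k, i ∈ fiber k ↔ π i = k) : HasSum (fun k => ∑ i ∈ fiber k, f i) a := by
  refine ((Equiv.sigmaFiberEquiv π).hasSum_iff.mpr hf).sigma fun k => ?_
  exact (Equiv.subtypeEquivRight fun i => hfiber i k).hasSum_iff.mp ((fiber k).hasSum f)

theorem hasSum_sum_antidiagonal {A M : Type*} [AddMonoid A] [Finset.HasAntidiagonal A]
    [AddCommMonoid M] [TopologicalSpace M] [ContinuousAdd M] [RegularSpace M] {f : A × A → M}
    {a : M} (hf : HasSum f a) : HasSum (fun n => ∑ p ∈ antidiagonal n, f p) a :=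
  hasSum_sum_fiber hf (fun p => p.1 + p.2) antidiagonal fun _ _ =>
    Finset.HasAntidiagonal.mem_antidiagonal

theorem summable_of_summable_sum_antidiagonal {A : Type*} [AddMonoid A] [Finset.HasAntidiagonal A]
    {f : A × A → ℝ} (hf : ∀ p, 0 ≤ f p) (h : Summable fun n => ∑ p ∈ antidiagonal n, f p) :
    Summable f := by
  refine Finset.HasAntidiagonal.sigmaAntidiagonalEquivProd.summable_iff.mp <|
    (summable_sigma_of_nonneg fun _ => hf _).mpr
      ⟨fun n => Summable.of_finite, h.congr fun n => ?_⟩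
  rw [tsum_fintype]
  exact (Finset.sum_coe_sort (antidiagonal n) f).symm

theorem summable_norm_mul_of_summable_sq {ι R : Type*} [NonUnitalSeminormedRing R] {f g : ι → R}
    (hf : Summable fun i => ‖f i‖ ^ 2) (hg : Summable fun i => ‖g i‖ ^ 2) :
    Summable fun i => ‖f i * g i‖ := by
  refine (hf.add hg).of_nonneg_of_le (fun _ => norm_nonneg _) fun i => ?_
  calc ‖f i * g i‖ ≤ ‖f i‖ * ‖g i‖ := norm_mul_le _ _
    _ ≤ ‖f i‖ ^ 2 + ‖g i‖ ^ 2 := by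
      nlinarith [two_mul_le_add_sq ‖f i‖ ‖g i‖, norm_nonneg (f i), norm_nonneg (g i)]

theorem summable_overlap {ι κ : Type*} {Φ : ι → ℂ} (hΦ : Summable fun i => ‖Φ i‖ ^ 2)
    {a b c d : κ → ι} (hac : Function.Injective fun x => (a x, c x))
    (hbd : Function.Injective fun x => (b x, d x)) :
    Summable fun x => Φ (a x) * conj (Φ (b x)) * (Φ (c x) * conj (Φ (d x))) := by
  have hsq : Summable fun p : ι × ι => ‖Φ p.1 * Φ p.2‖ ^ 2 := by
    simpa only [norm_mul, mul_pow] using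
      hΦ.mul_of_nonneg hΦ (fun _ => sq_nonneg _) (fun _ => sq_nonneg _)
  have hconj : Summable fun x => ‖conj (Φ (b x) * Φ (d x))‖ ^ 2 := by
    simpa only [RCLike.norm_conj, Function.comp_def] using hsq.comp_injective hbd
  refine (summable_norm_mul_of_summable_sq (hsq.comp_injective hac) hconj).of_norm.congr
    fun x => ?_
  rw [map_mul]
  ring

theorem convexOn_of_hasSum {ι E : Type*} [AddCommMonoid E] [Module ℝ E] {s : Set E}
    (hs : Convex ℝ s) {f : ι → E → ℝ} {g : E → ℝ} (hf : ∀ i, ConvexOn ℝ s (f i))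
    (hg : ∀ x ∈ s, HasSum (fun i => f i x) (g x)) : ConvexOn ℝ s g :=
  ⟨hs, fun x hx y hy a b ha hb hab =>
    hasSum_le (fun i => (hf i).2 hx hy ha hb hab) (hg _ (hs hx hy ha hb hab))
      (((hg x hx).const_smul a).add ((hg y hy).const_smul b))⟩

theorem analyticOnNhd_ball_of_hasSum_pow {𝕜 : Type*} [RCLike 𝕜] {c : ℕ → 𝕜} {f : 𝕜 → 𝕜} {x : 𝕜}
    {r : ℝ} (h : ∀ y ∈ Metric.ball (0 : 𝕜) r, HasSum (fun n => c n * y ^ n) (f (x + y))) :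
    AnalyticOnNhd 𝕜 f (Metric.ball x r) := by
  rcases le_or_gt r 0 with hr | hr
  · simp [Metric.ball_eq_empty.mpr hr]
  lift r to NNReal using hr.le
  have hball : HasFPowerSeriesOnBall f (.ofScalars 𝕜 c) x r :=
    { r_le := ENNReal.le_of_forall_nnreal_lt fun t ht => by
        have hmem : ((t : ℝ) : 𝕜) ∈ Metric.ball (0 : 𝕜) r := by simpa using ht
        refine FormalMultilinearSeries.le_radius_of_tendsto _ (l := 0) ?_
        simpa using (h _ hmem).summable.tendsto_atTop_zero.norm
      r_pos := by simpa using hr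
      hasSum := fun {y} hy => by
        simpa [FormalMultilinearSeries.ofScalars] using h y (by simpa using hy) }
  simpa using hball.analyticOnNhd

theorem iteratedDeriv_two_nonneg_of_convexOn {s : Set ℝ} (hs : IsOpen s) {g : ℝ → ℝ}
    (hg : ConvexOn ℝ s g) (hd : DifferentiableOn ℝ g s) {x : ℝ} (hx : x ∈ s) :
    0 ≤ iteratedDeriv 2 g x := by
  have hmono : MonotoneOn (deriv g) s :=
    hg.monotoneOn_deriv fun y hy => (hd y hy).differentiableAt (hs.mem_nhds hy)
  rw [iteratedDeriv_succ, iteratedDeriv_one, ← derivWithin_of_isOpen hs hx]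
  exact hmono.derivWithin_nonneg

end Series

section Purity

theorem partialTraceB_projector_apply (Φ : TwoMode) (m n : ℕ) :
    partialTraceB (projector Φ) m n = ∑' k, Φ (m, k) * conj (Φ (n, k)) :=
  rfl

/-- The summand of `Tr[ρ ^ 2]` for the reduced state `ρ` of `Φ`. Two copies of `Φ` are involved: in
the index `((m, n), (k, l))`, `m` and `n` are photon numbers of the mode `a` and `k` and `l` are
photon numbers of the mode `b`. -/
noncomputable def purityTerm (Φ : TwoMode) (q : (ℕ × ℕ) × (ℕ × ℕ)) : ℂ :=
  Φ (q.1.1, q.2.1) * conj (Φ (q.1.2, q.2.1)) * (Φ (q.1.2, q.2.2) * conj (Φ (q.1.1, q.2.2)))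

theorem conj_tsum_purityTerm (Φ : TwoMode) :
    conj (∑' q, purityTerm Φ q) = ∑' q, purityTerm Φ q := by
  rw [Complex.conj_tsum, ← ((Equiv.refl (ℕ × ℕ)).prodCongr (Equiv.prodComm ℕ ℕ)).tsum_eq]
  refine tsum_congr fun q => ?_
  simp only [purityTerm, Equiv.prodCongr_apply, Equiv.coe_refl, Equiv.coe_prodComm, Prod.map_fst,
    Prod.map_snd, id_eq, Prod.fst_swap, Prod.snd_swap, map_mul, Complex.conj_conj]
  ring

variable {Φ : TwoMode} (hΦ : Summable fun p => ‖Φ p‖ ^ 2)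
include hΦ

theorem partialTraceB_projector_mul (i j m n : ℕ) :
    partialTraceB (projector Φ) i j * partialTraceB (projector Φ) m n =
      ∑' q : ℕ × ℕ, Φ (i, q.1) * conj (Φ (j, q.1)) * (Φ (m, q.2) * conj (Φ (n, q.2))) := by
  have hrow (m : ℕ) : Summable fun k => ‖Φ (m, k)‖ ^ 2 :=
    hΦ.comp_injective (Prod.mk_right_injective m)
  have hentry (m n : ℕ) : Summable fun k => ‖Φ (m, k) * conj (Φ (n, k))‖ :=
    summable_norm_mul_of_summable_sq (hrow m) (by simpa only [RCLike.norm_conj] using hrow n)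
  simp only [partialTraceB_projector_apply]
  exact tsum_mul_tsum_of_summable_norm (hentry i j) (hentry m n)

theorem summable_partialTraceB_projector_mul (i j : ℕ) :
    Summable fun k => partialTraceB (projector Φ) i k * partialTraceB (projector Φ) k j := by
  simp only [partialTraceB_projector_mul hΦ]
  refine Summable.prod (f := fun x : ℕ × ℕ × ℕ => Φ (i, x.2.1) * conj (Φ (x.1, x.2.1)) *
    (Φ (x.1, x.2.2) * conj (Φ (j, x.2.2)))) (summable_overlap hΦ ?_ ?_) <;>
  · rintro ⟨k, l, l'⟩ ⟨k', l₁, l₁'⟩ h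
    simp_all

theorem summable_purityTerm : Summable (purityTerm Φ) := by
  refine summable_overlap hΦ ?_ ?_ <;>
  · rintro ⟨⟨m, n⟩, k, l⟩ ⟨⟨m', n'⟩, k', l'⟩ h
    simp_all

theorem hasSum_matMul_partialTraceB_projector_diag :
    HasSum (fun m => matMul (partialTraceB (projector Φ)) (partialTraceB (projector Φ)) m m)
      (∑' q, purityTerm Φ q) := by
  have hsummable := summable_purityTerm hΦ
  have hentries : HasSum (fun p : ℕ × ℕ =>
      partialTraceB (projector Φ) p.1 p.2 * partialTraceB (projector Φ) p.2 p.1)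
      (∑' q, purityTerm Φ q) := by
    simp only [partialTraceB_projector_mul hΦ]
    exact hsummable.hasSum.prod_fiberwise fun p => (hsummable.prod_factor p).hasSum
  exact hentries.prod_fiberwise fun m => (hentries.summable.prod_factor m).hasSum

end Purity

section OutputState

/-- The amplitude `⟨0| aⁿ |ψ⟩ = √n! ψₙ`. In these coordinates the binomial coefficients of the
output state factor into a part for each mode. -/
noncomputable def annihilationAmplitude (ψ : Mode) (n : ℕ) : ℂ := ψ n * (√(n ! : ℝ) : ℝ)

/-- The coefficient of the overlap of four annihilation amplitudes in `purityTerm (outputState ψ T)`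
at the index `((m, n), (k, l))`. -/
noncomputable def lossKernel (T : ℝ) (q : (ℕ × ℕ) × (ℕ × ℕ)) : ℝ :=
  T ^ (q.1.1 + q.1.2) * (1 - T) ^ (q.2.1 + q.2.2) / (q.1.1 ! * q.1.2 ! * q.2.1 ! * q.2.2 !)

variable {ψ : Mode} {T : ℝ}

theorem outputState_eq_annihilationAmplitude_mul (hT : T ∈ Set.Icc (0 : ℝ) 1) (m k : ℕ) :
    outputState ψ T (m, k) =
      annihilationAmplitude ψ (m + k) * ((√(T ^ m / m !) * √((1 - T) ^ k / k !) : ℝ) : ℂ) := by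
  have hT₀ : 0 ≤ T := hT.1
  have hsqrt : √((m + k).choose m * T ^ m * (1 - T) ^ k) =
      √((m + k)! : ℝ) * (√(T ^ m / m !) * √((1 - T) ^ k / k !)) := by
    rw [← Real.sqrt_mul (by positivity), ← Real.sqrt_mul (by positivity), Nat.cast_add_choose]
    congr 1
    ring
  rw [outputState_apply ψ hT, hsqrt, annihilationAmplitude, Complex.ofReal_mul, mul_assoc]

theorem purityTerm_outputState (hT : T ∈ Set.Icc (0 : ℝ) 1) (q : (ℕ × ℕ) × (ℕ × ℕ)) :
    purityTerm (outputState ψ T) q = (lossKernel T q : ℂ) *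
      (annihilationAmplitude ψ (q.1.1 + q.2.1) * annihilationAmplitude ψ (q.1.2 + q.2.2) *
        conj (annihilationAmplitude ψ (q.1.2 + q.2.1) *
          annihilationAmplitude ψ (q.1.1 + q.2.2))) := by
  obtain ⟨⟨m, n⟩, k, l⟩ := q
  have hT₀ : 0 ≤ T := hT.1
  have hT₁ : 0 ≤ 1 - T := sub_nonneg.mpr hT.2
  have hkernel : lossKernel T ((m, n), (k, l)) = √(T ^ m / m !) ^ 2 * √(T ^ n / n !) ^ 2 *
      (√((1 - T) ^ k / k !) ^ 2 * √((1 - T) ^ l / l !) ^ 2) := by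
    repeat rw [Real.sq_sqrt (by positivity)]
    simp only [lossKernel, pow_add]
    field_simp
  simp only [purityTerm, hkernel, outputState_eq_annihilationAmplitude_mul hT, map_mul,
    Complex.conj_ofReal, Complex.ofReal_mul, Complex.ofReal_pow]
  ring

theorem sum_antidiagonal_norm_sq_outputState (hT : T ∈ Set.Icc (0 : ℝ) 1) (N : ℕ) :
    ∑ p ∈ antidiagonal N, ‖outputState ψ T p‖ ^ 2 = ‖ψ N‖ ^ 2 := by
  have hT₀ : 0 ≤ T := hT.1
  have hT₁ : 0 ≤ 1 - T := sub_nonneg.mpr hT.2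
  calc ∑ p ∈ antidiagonal N, ‖outputState ψ T p‖ ^ 2
      = ∑ p ∈ antidiagonal N, ‖ψ N‖ ^ 2 * (N.choose p.1 • (T ^ p.1 * (1 - T) ^ p.2)) := by
        refine Finset.sum_congr rfl fun ⟨m, k⟩ hp => ?_
        obtain rfl : m + k = N := Finset.HasAntidiagonal.mem_antidiagonal.mp hp
        rw [outputState_apply ψ hT, norm_mul, mul_pow, Complex.norm_real, Real.norm_eq_abs, sq_abs,
          Real.sq_sqrt (by positivity), nsmul_eq_mul, mul_assoc (Nat.cast _)]
    _ = ‖ψ N‖ ^ 2 * (T + (1 - T)) ^ N := by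
        rw [← Finset.mul_sum, ← (Commute.all T (1 - T)).add_pow']
    _ = ‖ψ N‖ ^ 2 := by rw [add_sub_cancel, one_pow, mul_one]

theorem hasSum_norm_sq_outputState {S : ℝ} (hψ : HasSum (fun n => ‖ψ n‖ ^ 2) S)
    (hT : T ∈ Set.Icc (0 : ℝ) 1) : HasSum (fun p => ‖outputState ψ T p‖ ^ 2) S := by
  simp only [← sum_antidiagonal_norm_sq_outputState (ψ := ψ) hT] at hψ
  have hsum := (summable_of_summable_sum_antidiagonal (fun _ => sq_nonneg _) hψ.summable).hasSum
  rwa [(hasSum_sum_antidiagonal hsum).unique hψ] at hsum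

theorem summable_norm_sq_outputState (hψ : Summable fun n => ‖ψ n‖ ^ 2)
    (hT : T ∈ Set.Icc (0 : ℝ) 1) : Summable fun p => ‖outputState ψ T p‖ ^ 2 :=
  (hasSum_norm_sq_outputState hψ.hasSum hT).summable

theorem tsum_purityTerm_outputState (hψ : Summable fun n => ‖ψ n‖ ^ 2)
    (hT : T ∈ Set.Icc (0 : ℝ) 1) : ∑' q, purityTerm (outputState ψ T) q = (purity ψ T : ℂ) := by
  have hpurity : purity ψ T = (∑' q, purityTerm (outputState ψ T) q).re :=
    congrArg Complex.re
      (hasSum_matMul_partialTraceB_projector_diag (summable_norm_sq_outputState hψ hT)).tsum_eq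
  rw [hpurity, Complex.conj_eq_iff_re.mp (conj_tsum_purityTerm _)]

theorem hasSum_matMul_lossyState_diag (hψ : Summable fun n => ‖ψ n‖ ^ 2)
    (hT : T ∈ Set.Icc (0 : ℝ) 1) :
    HasSum (fun m => matMul (lossyState ψ T) (lossyState ψ T) m m) (purity ψ T : ℂ) := by
  rw [← tsum_purityTerm_outputState hψ hT]
  exact hasSum_matMul_partialTraceB_projector_diag (summable_norm_sq_outputState hψ hT)

end OutputState

section GeneratingFunction

theorem inv_factorial_smul_add_pow {𝕜 A : Type*} [Field 𝕜] [CharZero 𝕜] [Semiring A] [Algebra 𝕜 A]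
    {x y : A} (h : Commute x y) (N : ℕ) :
    (N ! : 𝕜)⁻¹ • (x + y) ^ N =
      ∑ p ∈ antidiagonal N, ((p.1 ! : 𝕜)⁻¹ • x ^ p.1) * ((p.2 ! : 𝕜)⁻¹ • y ^ p.2) := by
  rw [h.add_pow', Finset.smul_sum]
  refine Finset.sum_congr rfl fun ⟨m, k⟩ hp => ?_
  obtain rfl : m + k = N := Finset.HasAntidiagonal.mem_antidiagonal.mp hp
  have hfac : ((m + k)! : 𝕜) ≠ 0 := Nat.cast_ne_zero.mpr (Nat.factorial_ne_zero _)
  rw [← Nat.cast_smul_eq_nsmul 𝕜, smul_smul, smul_mul_smul_comm, Nat.cast_add_choose]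
  congr 1
  field_simp

variable {R : Type*} [CommRing R] [Algebra ℝ R] (x y u v : R) (T : ℝ)

theorem lossForm_eq_sub_mul_sub_add_add_mul_add :
    (T • (x * v) + T • (y * u)) + ((1 - T) • (x * u) + (1 - T) • (y * v)) =
      ((1 - 2 * T) / 2) • ((x - y) * (u - v)) + (1 / 2 : ℝ) • ((x + y) * (u + v)) := by
  simp only [mul_sub, sub_mul, mul_add, add_mul]
  module

theorem sum_lossKernel_smul (N : ℕ) :
    ∑ s ∈ antidiagonal N, ∑ q ∈ antidiagonal s.1 ×ˢ antidiagonal s.2, lossKernel T q •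
        (x ^ (q.1.1 + q.2.1) * y ^ (q.1.2 + q.2.2) * (u ^ (q.1.2 + q.2.1) * v ^ (q.1.1 + q.2.2))) =
      ∑ p ∈ antidiagonal N, ((1 - 2 * T) ^ p.1 / (p.1 ! * p.2 ! * 2 ^ (p.1 + p.2))) •
        ((x - y) ^ p.1 * (x + y) ^ p.2 * ((u - v) ^ p.1 * (u + v) ^ p.2)) := by
  have h := congrArg (fun z => (N ! : ℝ)⁻¹ • z ^ N)
    (lossForm_eq_sub_mul_sub_add_add_mul_add x y u v T)
  simp only [inv_factorial_smul_add_pow (A := R) (Commute.all _ _), Finset.sum_mul_sum,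
    ← Finset.sum_product'] at h
  convert h using 2 with s _ p _
  · refine Finset.sum_congr rfl fun q _ => ?_
    simp only [smul_pow, smul_smul, smul_mul_smul_comm]
    congr 1
    · simp only [lossKernel, pow_add]
      field_simp
    · ring
  · simp only [smul_pow, mul_pow, smul_smul, smul_mul_smul_comm]
    congr 1
    · simp only [pow_add, div_pow, one_pow]
      field_simp
    · ring

end GeneratingFunction

section PairAmplitude

/-- The linear functional `a ⊗ b ↦ g a * h b`. -/
noncomputable def tensorFunctional {A B : Type*} [AddCommGroup A] [Module ℝ A]
    [AddCommGroup B] [Module ℝ B] (g : A →ₗ[ℝ] ℂ) (h : B →ₗ[ℝ] ℂ) : A ⊗[ℝ] B →ₗ[ℝ] ℂ :=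
  LinearMap.mul' ℝ ℂ ∘ₗ TensorProduct.map g h

theorem tensorFunctional_tmul {A B : Type*} [AddCommGroup A] [Module ℝ A] [AddCommGroup B]
    [Module ℝ B] (g : A →ₗ[ℝ] ℂ) (h : B →ₗ[ℝ] ℂ) (a : A) (b : B) :
    tensorFunctional g h (a ⊗ₜ b) = g a * h b :=
  rfl

/-- The linear functional on polynomials with moments `X ^ n ↦ f n`. -/
noncomputable def momentFunctional (f : ℕ → ℂ) : ℝ[X] →ₗ[ℝ] ℂ :=
  (Polynomial.basisMonomials ℝ).constr ℝ f

theorem momentFunctional_X_pow (f : ℕ → ℂ) (n : ℕ) :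
    momentFunctional f (Polynomial.X ^ n) = f n := by
  rw [← Polynomial.monomial_one_right_eq_X_pow]
  simpa only [momentFunctional, Polynomial.coe_basisMonomials] using
    (Polynomial.basisMonomials ℝ).constr_basis ℝ f n

/-- The functional `xⁱ yʲ ↦ f i * f j` on polynomials in `x = X ⊗ 1` and `y = 1 ⊗ X`. For
`f n = ⟨0| aⁿ |ψ⟩` it is the vacuum amplitude of the operator polynomial applied to `|ψ, ψ⟩`. -/
noncomputable def pairFunctional (f : ℕ → ℂ) : ℝ[X] ⊗[ℝ] ℝ[X] →ₗ[ℝ] ℂ :=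
  tensorFunctional (momentFunctional f) (momentFunctional f)

theorem pairFunctional_comm (f : ℕ → ℂ) (z : ℝ[X] ⊗[ℝ] ℝ[X]) :
    pairFunctional f (Algebra.TensorProduct.comm ℝ ℝ[X] ℝ[X] z) = pairFunctional f z := by
  induction z with
  | zero => simp only [map_zero]
  | tmul a b => simp only [Algebra.TensorProduct.comm_tmul, pairFunctional, tensorFunctional_tmul,
      mul_comm]
  | add z w hz hw => simp only [map_add, hz, hw]

/-- The value of `pairFunctional f` at `(x - y) ^ r * (x + y) ^ t`: up to normalization, the
amplitude of finding `r` and `t` photons behind a balanced beam splitter fed with two copies of a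
state. -/
noncomputable def pairAmplitude (f : ℕ → ℂ) (p : ℕ × ℕ) : ℂ :=
  pairFunctional f ((Polynomial.X ⊗ₜ 1 - 1 ⊗ₜ Polynomial.X) ^ p.1 *
    (Polynomial.X ⊗ₜ 1 + 1 ⊗ₜ Polynomial.X) ^ p.2)

theorem pairAmplitude_of_odd (f : ℕ → ℂ) {r : ℕ} (hr : Odd r) (t : ℕ) :
    pairAmplitude f (r, t) = 0 := by
  -- Exchanging the two copies fixes `pairFunctional f` and changes the sign of `(x - y) ^ r`.
  refine self_eq_neg.mp ?_
  calc pairAmplitude f (r, t)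
      = pairFunctional f ((1 ⊗ₜ Polynomial.X - Polynomial.X ⊗ₜ 1) ^ r *
          (1 ⊗ₜ Polynomial.X + Polynomial.X ⊗ₜ 1) ^ t) := by
        rw [pairAmplitude, ← pairFunctional_comm]
        simp only [map_mul, map_pow, map_sub, map_add, Algebra.TensorProduct.comm_tmul]
    _ = -pairAmplitude f (r, t) := by
        rw [← neg_sub, hr.neg_pow (α := ℝ[X] ⊗[ℝ] ℝ[X]), add_comm, neg_mul, map_neg, pairAmplitude]

theorem sum_lossKernel_mul_overlap (f : ℕ → ℂ) (T : ℝ) (N : ℕ) :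
    ∑ s ∈ antidiagonal N, ∑ q ∈ antidiagonal s.1 ×ˢ antidiagonal s.2, (lossKernel T q : ℂ) *
        (f (q.1.1 + q.2.1) * f (q.1.2 + q.2.2) *
          conj (f (q.1.2 + q.2.1) * f (q.1.1 + q.2.2))) =
      ((∑ p ∈ antidiagonal N, (1 - 2 * T) ^ p.1 *
        (‖pairAmplitude f p‖ ^ 2 / (p.1 ! * p.2 ! * 2 ^ (p.1 + p.2))) : ℝ) : ℂ) := by
  let x : ℝ[X] ⊗[ℝ] ℝ[X] := Polynomial.X ⊗ₜ 1
  let y : ℝ[X] ⊗[ℝ] ℝ[X] := 1 ⊗ₜ Polynomial.X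
  let L := tensorFunctional (pairFunctional f)
    (Complex.conjAe.toLinearMap ∘ₗ pairFunctional f)
  have hL (a b : ℝ[X] ⊗[ℝ] ℝ[X]) : L (a ⊗ₜ b) = pairFunctional f a * conj (pairFunctional f b) :=
    rfl
  have hxy (i j : ℕ) : pairFunctional f (x ^ i * y ^ j) = f i * f j := by
    simp [x, y, pairFunctional, tensorFunctional_tmul, momentFunctional_X_pow]
  have h := congrArg L (sum_lossKernel_smul (x ⊗ₜ[ℝ] 1) (y ⊗ₜ[ℝ] 1)
    ((1 : ℝ[X] ⊗[ℝ] ℝ[X]) ⊗ₜ[ℝ] x) (1 ⊗ₜ[ℝ] y) T N)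
  simp only [← TensorProduct.add_tmul, ← TensorProduct.sub_tmul, ← TensorProduct.tmul_add,
    ← TensorProduct.tmul_sub, Algebra.TensorProduct.tmul_pow, Algebra.TensorProduct.tmul_mul_tmul,
    one_pow, one_mul, mul_one, map_sum, map_smul, hL, hxy, Complex.real_smul] at h
  rw [h, Complex.ofReal_sum]
  refine Finset.sum_congr rfl fun p _ => ?_
  rw [Complex.mul_conj, Complex.normSq_eq_norm_sq]
  simp only [pairAmplitude, x, y]
  push_cast
  ring

end PairAmplitude

section PowerSeries

/-- The probability of finding `r` and `t` photons behind a balanced beam splitter fed with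
`|ψ, ψ⟩`. It is the contribution of `(r, t)` to the coefficient of `(1 - 2 T) ^ r` in the purity. -/
noncomputable def purityWeight (ψ : Mode) (p : ℕ × ℕ) : ℝ :=
  ‖pairAmplitude (annihilationAmplitude ψ) p‖ ^ 2 / (p.1 ! * p.2 ! * 2 ^ (p.1 + p.2))

/-- The coefficients `p_r` of the purity as a power series in `1 - 2 T`. -/
noncomputable def purityCoeff (ψ : Mode) (r : ℕ) : ℝ := ∑' t, purityWeight ψ (r, t)

theorem purityWeight_nonneg (ψ : Mode) (p : ℕ × ℕ) : 0 ≤ purityWeight ψ p := by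
  unfold purityWeight
  positivity

theorem purityCoeff_nonneg (ψ : Mode) (r : ℕ) : 0 ≤ purityCoeff ψ r :=
  tsum_nonneg fun _ => purityWeight_nonneg _ _

theorem purityCoeff_of_odd (ψ : Mode) {r : ℕ} (hr : Odd r) : purityCoeff ψ r = 0 := by
  simp [purityCoeff, purityWeight, pairAmplitude_of_odd _ hr]

variable {ψ : Mode} (hψ : Summable fun n => ‖ψ n‖ ^ 2)
include hψ

theorem hasSum_sum_antidiagonal_purityWeight {T : ℝ} (hT : T ∈ Set.Icc (0 : ℝ) 1) :
    HasSum (fun N => ∑ p ∈ antidiagonal N, (1 - 2 * T) ^ p.1 * purityWeight ψ p)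
      (purity ψ T) := by
  have hterm : HasSum (purityTerm (outputState ψ T)) (purity ψ T) :=
    tsum_purityTerm_outputState hψ hT ▸
      (summable_purityTerm (summable_norm_sq_outputState hψ hT)).hasSum
  have hphotons := hasSum_sum_antidiagonal <|
    hasSum_sum_fiber hterm (fun q => (q.1.1 + q.1.2, q.2.1 + q.2.2))
      (fun s => antidiagonal s.1 ×ˢ antidiagonal s.2) (by simp [Prod.ext_iff])
  simp only [purityTerm_outputState hT, sum_lossKernel_mul_overlap] at hphotons
  exact Complex.hasSum_ofReal.mp hphotons

theorem summable_purityWeight : Summable (purityWeight ψ) := by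
  have h := hasSum_sum_antidiagonal_purityWeight hψ (T := 0) (by simp)
  simp only [mul_zero, sub_zero, one_pow, one_mul] at h
  exact summable_of_summable_sum_antidiagonal (purityWeight_nonneg ψ) h.summable

theorem hasSum_purityCoeff_mul_pow {T : ℝ} (hT : T ∈ Set.Icc (0 : ℝ) 1) :
    HasSum (fun r => purityCoeff ψ r * (1 - 2 * T) ^ r) (purity ψ T) := by
  have habs : |1 - 2 * T| ≤ 1 := abs_le.mpr ⟨by linarith [hT.2], by linarith [hT.1]⟩
  have hsummable : Summable fun p : ℕ × ℕ => (1 - 2 * T) ^ p.1 * purityWeight ψ p := by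
    refine (summable_purityWeight hψ).of_norm_bounded fun p => ?_
    rw [norm_mul, norm_pow, Real.norm_of_nonneg (purityWeight_nonneg ψ p)]
    exact mul_le_of_le_one_left (purityWeight_nonneg ψ p) (pow_le_one₀ (norm_nonneg _) habs)
  have hsum := hsummable.hasSum
  rw [(hasSum_sum_antidiagonal hsum).unique (hasSum_sum_antidiagonal_purityWeight hψ hT)] at hsum
  simpa only [tsum_mul_left, mul_comm, purityCoeff] using
    hsum.prod_fiberwise fun r => (hsummable.prod_factor r).hasSum

theorem convexOn_purity : ConvexOn ℝ (Set.Icc 0 1) (purity ψ) := by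
  refine convexOn_of_hasSum (convex_Icc 0 1) (fun r => ?_) fun T => hasSum_purityCoeff_mul_pow hψ
  rcases Nat.even_or_odd r with hr | hr
  · have hpow : ConvexOn ℝ Set.univ fun T : ℝ => (1 - 2 * T) ^ r := by
      refine (hr.convexOn_pow.comp_affineMap (AffineMap.lineMap (1 : ℝ) (-1))).congr fun T _ => ?_
      rw [Function.comp_apply, AffineMap.lineMap_apply_ring']
      ring
    exact (hpow.smul (purityCoeff_nonneg ψ r)).subset (Set.subset_univ _) (convex_Icc 0 1)
  · simpa only [purityCoeff_of_odd ψ hr, zero_mul] using convexOn_const 0 (convex_Icc 0 1)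

theorem analyticOnNhd_purity : AnalyticOnNhd ℝ (purity ψ) (Set.Ioo 0 1) := by
  rw [Real.Ioo_eq_ball]
  refine analyticOnNhd_ball_of_hasSum_pow (c := fun r => purityCoeff ψ r * (-2) ^ r) fun y hy => ?_
  obtain ⟨hy₁, hy₂⟩ := abs_lt.mp (mem_ball_zero_iff.mp hy)
  have hT : (0 + 1) / 2 + y ∈ Set.Icc (0 : ℝ) 1 := ⟨by linarith, by linarith⟩
  have hcenter : 1 - 2 * ((0 + 1) / 2 + y) = -2 * y := by ring
  simpa only [hcenter, mul_pow, mul_assoc] using hasSum_purityCoeff_mul_pow hψ hT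

end PowerSeries

end PhotonLoss

open PhotonLoss

theorem theorem2_general (ψ : lp (fun _ : ℕ => ℂ) 2) :
    (∀ T ∈ Set.Icc (0 : ℝ) 1,
      HasSum (fun p : ℕ × ℕ => ‖outputState ψ T p‖ ^ 2) (‖ψ‖ ^ 2) ∧
      (∀ i j : ℕ, Summable fun k : ℕ => lossyState ψ T i k * lossyState ψ T k j) ∧
      HasSum (fun m : ℕ => matMul (lossyState ψ T) (lossyState ψ T) m m) (purity ψ T : ℂ)) ∧
    ConvexOn ℝ (Set.Icc (0 : ℝ) 1) (purity ψ) ∧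
    ConcaveOn ℝ (Set.Icc (0 : ℝ) 1) (mixedness ψ) ∧
    AnalyticOnNhd ℝ (purity ψ) (Set.Ioo (0 : ℝ) 1) ∧
    (∀ T ∈ Set.Ioo (0 : ℝ) 1, 0 ≤ iteratedDeriv 2 (purity ψ) T) ∧
    ∃ c : ℕ → ℝ, (∀ m, 0 ≤ c m) ∧ (∀ m, Odd m → c m = 0) ∧
      ∀ T ∈ Set.Icc (0 : ℝ) 1, HasSum (fun m : ℕ => c m * (1 - 2 * T) ^ m) (purity ψ T) := by
  have hψ : HasSum (fun n => ‖ψ n‖ ^ 2) (‖ψ‖ ^ 2) := by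
    simpa using lp.hasSum_norm (p := 2) (by norm_num) ψ
  have hconv : ConvexOn ℝ (Set.Icc 0 1) (purity ψ) := convexOn_purity hψ.summable
  have hanalytic : AnalyticOnNhd ℝ (purity ψ) (Set.Ioo 0 1) := analyticOnNhd_purity hψ.summable
  refine ⟨fun T hT => ⟨hasSum_norm_sq_outputState hψ hT, ?_, ?_⟩, hconv, ?_, hanalytic,
    fun T hT => ?_, purityCoeff ψ, purityCoeff_nonneg ψ, fun _ => purityCoeff_of_odd ψ,
    fun T hT => hasSum_purityCoeff_mul_pow hψ.summable hT⟩
  · exact summable_partialTraceB_projector_mul (summable_norm_sq_outputState hψ.summable hT)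
  · exact hasSum_matMul_lossyState_diag hψ.summable hT
  · exact (concaveOn_const 1 (convex_Icc 0 1)).sub hconv
  · exact iteratedDeriv_two_nonneg_of_convexOn isOpen_Ioo
      (hconv.subset Set.Ioo_subset_Icc_self (convex_Ioo 0 1)) hanalytic.differentiableOn hT

theorem theorem2 (ψ : lp (fun _ : ℕ => ℂ) 2) (hψ : ‖ψ‖ = 1) :
    -- the objects are well defined: `Ψ_T` is a unit vector, and the series for `Tr[ρ_T ^ 2]`
    -- converge, with real value the purity
    (∀ T ∈ Set.Ioo (0 : ℝ) 1,
      HasSum (fun p : ℕ × ℕ => ‖PhotonLoss.outputState ψ T p‖ ^ 2) 1 ∧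
      (∀ i j : ℕ, Summable fun k : ℕ =>
        PhotonLoss.lossyState ψ T i k * PhotonLoss.lossyState ψ T k j) ∧
      HasSum (fun m : ℕ =>
          PhotonLoss.matMul (PhotonLoss.lossyState ψ T) (PhotonLoss.lossyState ψ T) m m)
        (PhotonLoss.purity ψ T : ℂ)) ∧
    -- the purity is convex, the mixedness concave
    ConvexOn ℝ (Set.Ioo (0 : ℝ) 1) (PhotonLoss.purity ψ) ∧
    ConcaveOn ℝ (Set.Ioo (0 : ℝ) 1) (PhotonLoss.mixedness ψ) ∧
    -- the second derivative of the purity exists and is nonnegative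
    ContDiffOn ℝ 2 (PhotonLoss.purity ψ) (Set.Ioo (0 : ℝ) 1) ∧
    (∀ T ∈ Set.Ioo (0 : ℝ) 1, 0 ≤ iteratedDeriv 2 (PhotonLoss.purity ψ) T) ∧
    -- power series in `1 - 2T` with nonnegative coefficients and even powers only
    ∃ c : ℕ → ℝ, (∀ m, 0 ≤ c m) ∧ (∀ m, Odd m → c m = 0) ∧
      ∀ T ∈ Set.Ioo (0 : ℝ) 1,
        HasSum (fun m : ℕ => c m * (1 - 2 * T) ^ m) (PhotonLoss.purity ψ T) := by
  obtain ⟨hstate, hconv, hconc, hanalytic, hderiv, c, hc, hodd, hsum⟩ := theorem2_general ψ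
  have hsub : Set.Ioo (0 : ℝ) 1 ⊆ Set.Icc 0 1 := Set.Ioo_subset_Icc_self
  exact ⟨fun T hT => by simpa [hψ] using hstate T (hsub hT), hconv.subset hsub (convex_Ioo 0 1),
    hconc.subset hsub (convex_Ioo 0 1), hanalytic.contDiffOn (uniqueDiffOn_Ioo 0 1), hderiv,
    c, hc, hodd, fun T hT => hsum T (hsub hT)⟩
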